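/- Let $\Omega\subset\mathbb R^d$ be open, $L^2(\Omega)$ the real $L^2$-space with Lebesgue measure, $h\ge 0$, and let $C=C([-h,0];L^2(\Omega))$ carry the supremum norm. Assume: (H1) $-A$ is the infinitesimal generator of a compact $C_0$-semigroup $(e^{-At})_{t\ge 0}$ on $L^2(\Omega)$, that is, $e^{-At}$ is a compact operator for every $t>0$; (H2) $F:C\to L^2(\Omega)$ has the form $F(\psi)=B\big(\psi(-r(\psi))\big)$, where $B:L^2(\Omega)\to L^2(\Omega)$ is a (possibly nonlinear) map that is Lipschitz and maps bounded sets to bounded sets, and the state-dependent delay $r:C\to[0,h]$ is Lipschitz. Then for every $\varphi\in C$ there is $t_\varphi>0$ such that the initial value problem $$\frac{du(t)}{dt}+Au(t)=F(u_t)\quad(t>0),\qquad u|_{[-h,0]}=\varphi,$$ where $u_t\in C$ is given by $u_t(\theta)=u(t+\theta)$ for $\theta\in[-h,0]$, has a mild solution on $[0,t_\varphi)$: a function $u\in C([-h,t_\varphi];L^2(\Omega))$ with $u|_{[-h,0]}=\varphi$ and $$u(t)=e^{-At}\varphi(0)+\int_0^t e^{-A(t-s)}F(u_s)\,ds,\qquad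 t\in[0,t_\varphi).$$ -/

import Mathlib

open Set Filter Topology MeasureTheory
open scoped NNReal

/-- The real Hilbert space `L²(Ω)` for a subset `Ω` of `ℝᵈ` with Lebesgue measure. -/
abbrev L2 {d : ℕ} (Ω : Set (EuclideanSpace ℝ (Fin d))) : Type :=
  Lp ℝ 2 (volume.restrict Ω)

section Semigroup

variable {E : Type*} [NormedAddCommGroup E] [NormedSpace ℝ E]

/-- The bounded operators `S t`, `t ≥ 0`, form a strongly continuous (`C₀`-) semigroup.
The values of `S` at negative times are irrelevant. -/
structure IsC0Semigroup (S : ℝ → E →L[ℝ] E) : Prop where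
  map_zero : S 0 = ContinuousLinearMap.id ℝ E
  map_add : ∀ s t : ℝ, 0 ≤ s → 0 ≤ t → S (s + t) = (S s).comp (S t)
  tendsto_zero : ∀ x : E, Tendsto (fun t => S t x) (𝓝[>] 0) (𝓝 x)

/-- A compact `C₀`-semigroup: `S t` is a compact operator for every `t > 0`. -/
structure IsCompactC0Semigroup (S : ℝ → E →L[ℝ] E) : Prop extends IsC0Semigroup S where
  isCompactOperator : ∀ t : ℝ, 0 < t → IsCompactOperator (S t)

/-- The (in general unbounded) operator `G` is the infinitesimal generator of `S`:
`x` lies in the domain of `G` and `G x = y` if and only if `(S t x - x) / t → y` as `t → 0+`. -/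
def IsInfinitesimalGenerator (G : E →ₗ.[ℝ] E) (S : ℝ → E →L[ℝ] E) : Prop :=
  ∀ x y : E, (x, y) ∈ G.graph ↔ Tendsto (fun t : ℝ => t⁻¹ • (S t x - x)) (𝓝[>] 0) (𝓝 y)

end Semigroup

section Delay

variable {E : Type*} [NormedAddCommGroup E] {h : ℝ}

/-- The map `F(φ) = B(φ(-r(φ)))` on `C([-h,0]; E)`, with state-dependent delay `r`
taking values in `[0,h]`. -/
def stateDelayMap (B : E → E) (r : C(Icc (-h) 0, E) → Icc (0 : ℝ) h)
    (φ : C(Icc (-h) 0, E)) : E :=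
  B (φ ⟨-(r φ : ℝ), neg_le_neg (r φ).2.2, neg_nonpos.2 (r φ).2.1⟩)

open Classical in
/-- The history segment `u_t ∈ C([-h,0]; E)`, `u_t(θ) = u(t + θ)`. It has this value whenever `u`
is continuous on `[t-h,t]`, and the default value `0` otherwise. -/
noncomputable def historySegment (h : ℝ) (u : ℝ → E) (t : ℝ) : C(Icc (-h) 0, E) :=
  if hu : Continuous (fun θ : Icc (-h) 0 => u (t + θ)) then ⟨_, hu⟩ else 0

/-- On the time interval of a solution the history segment is the genuine one. -/
theorem historySegment_apply {u : ℝ → E} {T t : ℝ} (hu : ContinuousOn u (Icc (-h) T))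
    (ht : t ∈ Icc 0 T) (θ : Icc (-h) 0) : historySegment h u t θ = u (t + θ) := by
  have hc : Continuous (fun θ : Icc (-h) 0 => u (t + θ)) := by
    refine hu.comp_continuous (by fun_prop) fun θ => ⟨?_, ?_⟩
    · linarith [θ.2.1, ht.1]
    · linarith [θ.2.2, ht.2]
  simp [historySegment, hc]

/-- `u ∈ C([-h,T]; E)` is a mild solution on `[-h,T)` of `u'(t) + A u(t) = F(u_t)`, `u_0 = φ`,
where `S t = e^{-At}`. The values of `u` outside `[-h,T]` are irrelevant. -/
structure IsMildSolution [NormedSpace ℝ E] (hh : 0 ≤ h) (S : ℝ → E →L[ℝ] E) (F : C(Icc (-h) 0, E) → E)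
    (φ : C(Icc (-h) 0, E)) (T : ℝ) (u : ℝ → E) : Prop where
  continuousOn : ContinuousOn u (Icc (-h) T)
  initial : ∀ θ : Icc (-h) 0, u θ = φ θ
  intervalIntegrable : ∀ t ∈ Ico 0 T,
    IntervalIntegrable (fun s => S (t - s) (F (historySegment h u s))) volume 0 t
  integral_eq : ∀ t ∈ Ico 0 T,
    u t = S t (φ ⟨0, neg_nonpos.2 hh, le_rfl⟩) + ∫ s in (0 : ℝ)..t, S (t - s) (F (historySegment h u s))

end Delay

/-!
Local existence of mild solutions of `u' + A u = F(u_t)` for a compact `C₀`-semigroup `S` and a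
continuous `F` that is bounded on bounded sets. Since the delay depends on the state, `F` is
in general not Lipschitz on `C([-h,0]; E)`, so the contraction principle does not apply and
existence comes from compactness.

Write `u = b + v`, where `b` is `φ` on `[-h,0]` and `S t (φ 0)` for `t ≥ 0`, so that
`v t = ∫ s in 0..t, S (t - s) (F (u_s))` has to be solved on `[0,T]`. No fixed point theorem is
needed: as in Tonelli's proof of Peano's theorem, replace `u_s` by `u_{s-δ}` with `δ > 0`. Then the
right-hand side up to time `t` only involves `v` up to time `t - δ`, and iterating it from `0`
reaches an exact solution after finitely many steps (`exists_iterate_delayedStep_fixed`). For a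
small `T` these solutions stay in the unit ball.

All of them satisfy `v 0 = 0` and `‖v t - S (t - s) (v s)‖ ≤ L * (t - s)` with one constant `L`.
Compactness of the semigroup makes the set of such functions relatively compact in `C([0,T]; E)`
(`isCompact_closure_almostOrbits`): up to an error `L * η` each value lies in the image of a ball
under the compact operator `S η`, so the values are totally bounded; on a totally bounded set
`S δ x → x` uniformly, which gives equicontinuity. A limit point as `δ → 0` solves the undelayed
equation, because the step is jointly continuous in `δ` and `v` (`continuous_delayedStep`).
-/

/-! ### Strongly continuous semigroups -/

section SemigroupLemmas

variable {E : Type*} [NormedAddCommGroup E] [NormedSpace ℝ E] {S : ℝ → E →L[ℝ] E}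

namespace IsC0Semigroup

theorem map_add_apply (hS : IsC0Semigroup S) {s t : ℝ} (hs : 0 ≤ s) (ht : 0 ≤ t) (x : E) :
    S (s + t) x = S s (S t x) := by
  rw [hS.map_add s t hs ht]; rfl

theorem tendsto_zero_Ici (hS : IsC0Semigroup S) (x : E) :
    Tendsto (fun t => S t x) (𝓝[≥] 0) (𝓝 x) := by
  rw [← Ioi_insert, nhdsWithin_insert, tendsto_sup]
  refine ⟨?_, hS.tendsto_zero x⟩
  rw [tendsto_pure_left]
  intro s hs
  simpa [hS.map_zero] using mem_of_mem_nhds hs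

/-- By the uniform boundedness principle, the semigroup is bounded near `0`: otherwise some
`t n → 0` would have `‖S (t n)‖ → ∞`, while `S (t n) x → x` for each `x`. -/
theorem exists_norm_le_near_zero [CompleteSpace E] (hS : IsC0Semigroup S) :
    ∃ δ > 0, ∃ C : ℝ, ∀ t ∈ Icc 0 δ, ‖S t‖ ≤ C := by
  by_contra! H
  choose t ht hlt using fun n : ℕ => H (1 / ((n : ℝ) + 1)) (by positivity) n
  have ht0 : Tendsto t atTop (𝓝[≥] 0) :=
    tendsto_nhdsWithin_iff.2 ⟨squeeze_zero (fun n => (ht n).1) (fun n => (ht n).2)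
      tendsto_one_div_add_atTop_nhds_zero_nat, Eventually.of_forall fun n => (ht n).1⟩
  obtain ⟨C, hC⟩ := banach_steinhaus (g := fun n => S (t n)) fun x => by
    obtain ⟨C, hC⟩ := ((hS.tendsto_zero_Ici x).comp ht0).norm.bddAbove_range
    exact ⟨C, fun n => hC ⟨n, rfl⟩⟩
  obtain ⟨n, hn⟩ := exists_nat_gt C
  linarith [hC n, hlt n]

theorem exists_norm_le [CompleteSpace E] (hS : IsC0Semigroup S) (b : ℝ) :
    ∃ M : ℝ, 1 ≤ M ∧ ∀ t ∈ Icc 0 b, ‖S t‖ ≤ M := by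
  obtain ⟨δ, hδ, C, hC⟩ := hS.exists_norm_le_near_zero
  have key : ∀ n : ℕ, ∀ t ∈ Icc 0 (n * δ), ‖S t‖ ≤ max C 1 ^ n := by
    intro n
    induction n with
    | zero =>
      rintro t ⟨h0, h1⟩
      obtain rfl : t = 0 := le_antisymm (by simpa using h1) h0
      simpa [hS.map_zero] using ContinuousLinearMap.norm_id_le
    | succ n ih =>
      rintro t ⟨h0, h1⟩
      push_cast at h1
      rcases le_total t δ with h | h
      · exact ((hC t ⟨h0, h⟩).trans (le_max_left _ _)).trans
          (le_self_pow₀ (le_max_right _ _) n.succ_ne_zero)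
      · rw [show t = (t - δ) + δ by ring, hS.map_add _ _ (by linarith) hδ.le, pow_succ]
        exact (ContinuousLinearMap.opNorm_comp_le _ _).trans
          (mul_le_mul (ih _ ⟨by linarith, by linarith⟩)
            ((hC δ ⟨hδ.le, le_rfl⟩).trans (le_max_left _ _)) (norm_nonneg _) (by positivity))
  obtain ⟨n, hn⟩ := exists_nat_gt (b / δ)
  rw [div_lt_iff₀ hδ] at hn
  exact ⟨max C 1 ^ n, one_le_pow₀ (le_max_right _ _), fun t ht => key n t ⟨ht.1, ht.2.trans hn.le⟩⟩

/-- A `C₀`-semigroup is jointly continuous in time and space. Negative times, where `S` is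
arbitrary, are replaced by `0`. -/
theorem continuous_apply [CompleteSpace E] (hS : IsC0Semigroup S) :
    Continuous fun p : ℝ × E => S (max p.1 0) p.2 := by
  rw [continuous_iff_continuousAt]
  rintro ⟨t₀, x₀⟩
  obtain ⟨M, hM1, hM⟩ := hS.exists_norm_le (max t₀ 0 + 1)
  have hnear : ∀ᶠ p : ℝ × E in 𝓝 (t₀, x₀), max p.1 0 < max t₀ 0 + 1 :=
    ((continuous_fst.max continuous_const).tendsto (t₀, x₀)).eventually_lt_const (by simp)
  have horbit : ∀ s t : ℝ, 0 ≤ s → s ≤ t → t ≤ max t₀ 0 + 1 →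
      ‖S t x₀ - S s x₀‖ ≤ M * ‖S |t - s| x₀ - x₀‖ := by
    intro s t hs hst ht
    have : S t x₀ - S s x₀ = S s (S |t - s| x₀ - x₀) := by
      rw [abs_of_nonneg (by linarith), map_sub, ← hS.map_add_apply hs (by linarith)]
      congr 3; ring
    rw [this]
    exact (S s).le_of_opNorm_le (hM s ⟨hs, hst.trans ht⟩) _
  have habs : Tendsto (fun p : ℝ × E => |max p.1 0 - max t₀ 0|) (𝓝 (t₀, x₀)) (𝓝[≥] 0) := by
    refine tendsto_nhdsWithin_iff.2 ⟨?_, Eventually.of_forall fun p => mem_Ici.2 (abs_nonneg _)⟩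
    exact (by fun_prop : Continuous fun p : ℝ × E => |max p.1 0 - max t₀ 0|).tendsto' _ _ (by simp)
  have hlim : Tendsto (fun p : ℝ × E => M * ‖p.2 - x₀‖ + M * ‖S |max p.1 0 - max t₀ 0| x₀ - x₀‖)
      (𝓝 (t₀, x₀)) (𝓝 0) := by
    have h1 : Tendsto (fun p : ℝ × E => M * ‖p.2 - x₀‖) (𝓝 (t₀, x₀)) (𝓝 0) :=
      (by fun_prop : Continuous fun p : ℝ × E => M * ‖p.2 - x₀‖).tendsto' _ _ (by simp)
    have h2 := ((((hS.tendsto_zero_Ici x₀).comp habs).sub_const x₀).norm).const_mul M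
    simpa using h1.add h2
  rw [ContinuousAt, tendsto_iff_norm_sub_tendsto_zero]
  refine squeeze_zero' (Eventually.of_forall fun p => norm_nonneg _) ?_ hlim
  filter_upwards [hnear] with p hp
  have e : S (max p.1 0) p.2 - S (max t₀ 0) x₀
      = S (max p.1 0) (p.2 - x₀) + (S (max p.1 0) x₀ - S (max t₀ 0) x₀) := by
    rw [map_sub]; abel
  rw [e]
  refine (norm_add_le _ _).trans (add_le_add ?_ ?_)
  · exact (S _).le_of_opNorm_le (hM _ ⟨le_max_right _ _, hp.le⟩) _
  · rcases le_total (max t₀ 0) (max p.1 0) with h | h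
    · exact horbit _ _ (le_max_right _ _) h hp.le
    · rw [norm_sub_rev, abs_sub_comm]
      exact horbit _ _ (le_max_right _ _) h (by linarith)

end IsC0Semigroup

/-! ### Compactness of families of almost orbits -/

/-- The functions on `[0,T]` that start at `0` and are orbits of the semigroup up to an error of
rate `L`. Every convolution `t ↦ ∫ s in 0..t, S (t - s) (g s)` with `‖S (t - s) (g s)‖ ≤ L`
is of this kind. -/
def almostOrbits (S : ℝ → E →L[ℝ] E) (T L : ℝ) : Set C(Icc 0 T, E) :=
  {v | (∀ t : Icc 0 T, (t : ℝ) = 0 → v t = 0) ∧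
    ∀ s t : Icc 0 T, (s : ℝ) ≤ t → ‖v t - S (t - s) (v s)‖ ≤ L * (t - s)}

/-- The values of all almost orbits form a totally bounded set: after discarding the error made
during the last `η` units of time, they lie in the image of a ball under the compact operator
`S η`. -/
theorem totallyBounded_values_almostOrbits [CompleteSpace E] (hS : IsCompactC0Semigroup S)
    (T L : ℝ) : TotallyBounded {x | ∃ v ∈ almostOrbits S T L, ∃ t, v t = x} := by
  have hnorm : ∀ v ∈ almostOrbits S T L, ∀ t : Icc 0 T, ‖v t‖ ≤ |L| * t := by
    intro v hv t
    have h0 : (0 : ℝ) ∈ Icc 0 T := ⟨le_rfl, t.2.1.trans t.2.2⟩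
    have := hv.2 ⟨0, h0⟩ t t.2.1
    rw [hv.1 ⟨0, h0⟩ rfl] at this
    simp only [map_zero, sub_zero] at this
    exact this.trans (mul_le_mul_of_nonneg_right (le_abs_self L) t.2.1)
  rw [Metric.totallyBounded_iff]
  intro ε hε
  obtain ⟨η, hη, hLη⟩ : ∃ η > 0, |L| * η < ε / 2 := by
    refine ⟨ε / 2 / (|L| + 1), by positivity, ?_⟩
    rw [mul_div_assoc', div_lt_iff₀ (by positivity)]
    nlinarith
  obtain ⟨K, hK, hsub⟩ :=
    IsCompactOperator.image_closedBall_subset_compact (f := (S η : E →ₗ[ℝ] E))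
      (hS.isCompactOperator η hη) (|L| * max T 0)
  obtain ⟨c, hc, hcov⟩ := Metric.totallyBounded_iff.1 hK.totallyBounded (ε / 2) (by positivity)
  refine ⟨c, hc, ?_⟩
  rintro _ ⟨v, hv, t, rfl⟩
  obtain ⟨z, hz, hvz⟩ : ∃ z ∈ K, dist (v t) z < ε / 2 := by
    rcases le_total (t : ℝ) η with h | h
    · refine ⟨0, hsub ⟨0, by simp; positivity, by simp⟩, ?_⟩
      rw [dist_zero_right]
      exact ((hnorm v hv t).trans (mul_le_mul_of_nonneg_left h (abs_nonneg _))).trans_lt hLη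
    · have hs : (t : ℝ) - η ∈ Icc 0 T := ⟨by linarith, by linarith [t.2.2]⟩
      refine ⟨S η (v ⟨_, hs⟩), hsub ⟨_, ?_, rfl⟩, ?_⟩
      · rw [mem_closedBall_zero_iff]
        exact (hnorm v hv _).trans
          (mul_le_mul_of_nonneg_left (hs.2.trans (le_max_left _ _)) (abs_nonneg _))
      · have := hv.2 ⟨_, hs⟩ t (by simp; linarith)
        simp only [sub_sub_cancel] at this
        rw [dist_eq_norm]
        exact (this.trans (mul_le_mul_of_nonneg_right (le_abs_self L) hη.le)).trans_lt hLη
  obtain ⟨y, hy, hzy⟩ := mem_iUnion₂.1 (hcov hz)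
  refine mem_iUnion₂.2 ⟨y, hy, ?_⟩
  rw [Metric.mem_ball] at hzy ⊢
  linarith [dist_triangle (v t) z y]

/-- By the Arzelà–Ascoli theorem almost orbits form a relatively compact set: an increment
`v t - v s` is `(S (t - s) - 1) (v s)` up to `L * (t - s)`, and `S δ x → x` uniformly on the
totally bounded set of values. -/
theorem isCompact_closure_almostOrbits [CompleteSpace E] (hS : IsCompactC0Semigroup S)
    (T L : ℝ) : IsCompact (closure (almostOrbits S T L)) := by
  set K := closure {x | ∃ v ∈ almostOrbits S T L, ∃ t, v t = x} with hKdef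
  have hK : IsCompact K :=
    (totallyBounded_values_almostOrbits hS T L).closure.isCompact_of_isClosed isClosed_closure
  have hmem : ∀ v ∈ almostOrbits S T L, ∀ t, v t ∈ K := fun v hv t =>
    subset_closure ⟨v, hv, t, rfl⟩
  let e := ContinuousMap.isometryEquivBoundedOfCompact (Icc 0 T) E
  have hequi : Equicontinuous
      (fun f : e '' almostOrbits S T L => (f.1 : Icc 0 T → E)) := by
    refine UniformEquicontinuous.equicontinuous (Metric.uniformEquicontinuous_iff.2 ?_)
    intro ε hε
    obtain ⟨U, hU, hSU⟩ := hK.mem_uniformity_of_prod (s := univ) (q := (0 : ℝ))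
      (f := fun t x => S (max t 0) x) hS.toIsC0Semigroup.continuous_apply.continuousOn
      (mem_univ _) (Metric.dist_mem_uniformity (half_pos hε))
    rw [nhdsWithin_univ] at hU
    obtain ⟨δ, hδ, hball⟩ := Metric.mem_nhds_iff.1 hU
    have hincr : ∀ v ∈ almostOrbits S T L, ∀ s t : Icc 0 T, (s : ℝ) ≤ t →
        dist s t < min δ (ε / 2 / (|L| + 1)) → dist (v s) (v t) < ε := by
      intro v hv s t hst hd
      rw [Subtype.dist_eq, Real.dist_eq, abs_sub_comm, abs_of_nonneg (by linarith)] at hd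
      have h1 : ‖S (t - s) (v s) - v s‖ < ε / 2 := by
        have := hSU ((t : ℝ) - s) (hball (by
          rw [mem_ball_zero_iff, Real.norm_of_nonneg (by linarith)]
          exact hd.trans_le (min_le_left _ _))) (v s) (hmem v hv s)
        simpa [hS.map_zero, dist_eq_norm, max_eq_left (sub_nonneg.2 hst)] using this
      have h2 : ‖v t - S (t - s) (v s)‖ ≤ ε / 2 := by
        refine (hv.2 s t hst).trans ?_
        have h3 := (lt_div_iff₀ (by positivity)).1 (hd.trans_le (min_le_right _ _))
        nlinarith [le_abs_self L, sub_nonneg.2 hst]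
      rw [dist_comm, dist_eq_norm, show v t - v s
        = (v t - S (t - s) (v s)) + (S (t - s) (v s) - v s) by abel]
      linarith [norm_add_le (v t - S (t - s) (v s)) (S (t - s) (v s) - v s)]
    refine ⟨min δ (ε / 2 / (|L| + 1)), by positivity, ?_⟩
    rintro s t hd ⟨_, v, hv, rfl⟩
    rcases le_total (s : ℝ) t with h | h
    · exact hincr v hv s t h hd
    · rw [dist_comm] at hd ⊢
      exact hincr v hv t s h hd
  have hcomp : IsCompact (closure (e '' almostOrbits S T L)) :=
    BoundedContinuousFunction.arzela_ascoli K hK _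
      (by rintro _ t ⟨v, hv, rfl⟩; exact hmem v hv t) hequi
  have himg : closure (e '' almostOrbits S T L) = e '' closure (almostOrbits S T L) :=
    (e.toHomeomorph.image_closure _).symm
  rw [himg] at hcomp
  exact e.toHomeomorph.isCompact_image.1 hcomp

end SemigroupLemmas

/-! ### History segments -/

section History

variable {E : Type*} [NormedAddCommGroup E] {h T : ℝ}

/-- The history segment at time `s` of the function `t ↦ b t + v t`, where `v`, given on `[0,T]`,
is extended to `ℝ` by its end values. -/
noncomputable def historyOfSum (h : ℝ) (hT : 0 ≤ T) (b : C(ℝ, E)) (v : C(Icc 0 T, E)) (s : ℝ) :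
    C(Icc (-h) 0, E) where
  toFun θ := b (s + θ) + v (projIcc 0 T hT (s + θ))

theorem historyOfSum_apply (hT : 0 ≤ T) (b : C(ℝ, E)) (v : C(Icc 0 T, E)) (s : ℝ)
    (θ : Icc (-h) 0) :
    historyOfSum h hT b v s θ = b (s + θ) + v (projIcc 0 T hT (s + θ)) := rfl

theorem continuous_historyOfSum (hT : 0 ≤ T) (b : C(ℝ, E)) :
    Continuous fun p : C(Icc 0 T, E) × ℝ => historyOfSum h hT b p.1 p.2 := by
  refine ContinuousMap.continuous_of_continuous_uncurry _ ?_
  have hproj : Continuous fun q : (C(Icc 0 T, E) × ℝ) × Icc (-h) 0 =>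
      projIcc 0 T hT (q.1.2 + q.2) := continuous_projIcc.comp (by fun_prop)
  have : Continuous fun q : (C(Icc 0 T, E) × ℝ) × Icc (-h) 0 =>
      b (q.1.2 + q.2) + q.1.1 (projIcc 0 T hT (q.1.2 + q.2)) := by
    fun_prop
  exact this

end History

/-! ### Convolution with a semigroup -/

section Convolution

variable {E : Type*} [NormedAddCommGroup E] [NormedSpace ℝ E] [CompleteSpace E]
  {S : ℝ → E →L[ℝ] E}

theorem IsC0Semigroup.continuous_integral {X : Type*} [TopologicalSpace X] (hS : IsC0Semigroup S)
    {g : X → ℝ → E} (hg : Continuous (Function.uncurry g)) {τ : X → ℝ} (hτ : Continuous τ) :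
    Continuous fun x => ∫ s in (0 : ℝ)..τ x, S (max (τ x - s) 0) (g x s) := by
  refine intervalIntegral.continuous_parametric_intervalIntegral_of_continuous
    (f := fun x s => S (max (τ x - s) 0) (g x s)) ?_ hτ
  exact hS.continuous_apply.comp
    (((hτ.comp continuous_fst).sub continuous_snd).prodMk hg)

/-- The function `t ↦ ∫ s in 0..t, S (t - s) (g s)` on `[0,T]`. The time `t - s` is written as
`max (t - s) 0`, which makes the integrand continuous in `s` on all of `ℝ`. -/
noncomputable def semigroupConvolution (hS : IsC0Semigroup S) (T : ℝ) (g : C(ℝ, E)) :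
    C(Icc 0 T, E) where
  toFun t := ∫ s in (0 : ℝ)..t, S (max (t - s) 0) (g s)
  continuous_toFun := hS.continuous_integral (g := fun _ => g) (by fun_prop) (by fun_prop)

theorem semigroupConvolution_apply (hS : IsC0Semigroup S) (T : ℝ) (g : C(ℝ, E)) (t : Icc 0 T) :
    semigroupConvolution hS T g t = ∫ s in (0 : ℝ)..t, S (max (t - s) 0) (g s) := rfl

theorem semigroupConvolution_mem_almostOrbits (hS : IsC0Semigroup S) {T M N : ℝ}
    (hM : ∀ t ∈ Icc 0 T, ‖S t‖ ≤ M) (hM0 : 0 ≤ M) {g : C(ℝ, E)}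
    (hg : ∀ s ∈ Icc 0 T, ‖g s‖ ≤ N) :
    semigroupConvolution hS T g ∈ almostOrbits S T (M * N) := by
  have hcont : ∀ t : ℝ, Continuous fun s => S (max (t - s) 0) (g s) := fun t =>
    hS.continuous_apply.comp (f := fun s : ℝ => (t - s, g s)) (by fun_prop)
  refine ⟨fun t ht => by simp [semigroupConvolution_apply, ht], fun s t hst => ?_⟩
  have hshift : S (t - s) (semigroupConvolution hS T g s)
      = ∫ σ in (0 : ℝ)..s, S (max (t - σ) 0) (g σ) := by
    rw [semigroupConvolution_apply, ← ContinuousLinearMap.intervalIntegral_comp_comm _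
      ((hcont s).intervalIntegrable _ _)]
    refine intervalIntegral.integral_congr fun σ hσ => ?_
    rw [uIcc_of_le s.2.1] at hσ
    have h1 : 0 ≤ (s : ℝ) - σ := sub_nonneg.2 hσ.2
    rw [max_eq_left h1, max_eq_left (by linarith [hst] : 0 ≤ (t : ℝ) - σ),
      ← hS.map_add_apply (by linarith) h1]
    congr 2; ring
  rw [hshift, semigroupConvolution_apply, intervalIntegral.integral_interval_sub_left
    ((hcont t).intervalIntegrable _ _) ((hcont t).intervalIntegrable _ _)]
  refine (intervalIntegral.norm_integral_le_of_norm_le_const fun σ hσ => ?_).trans_eq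
    (by rw [abs_of_nonneg (sub_nonneg.2 hst)])
  rw [uIoc_of_le hst] at hσ
  have hσ0 : 0 ≤ σ := s.2.1.trans hσ.1.le
  rw [max_eq_left (by linarith [hσ.2])]
  refine ((S _).le_of_opNorm_le (hM _ ⟨by linarith [hσ.2], by linarith [t.2.2]⟩) _).trans ?_
  exact mul_le_mul_of_nonneg_left (hg σ ⟨hσ0, hσ.2.trans t.2.2⟩) hM0

/-! ### The delayed approximations -/

variable {h T : ℝ}

/-- The map whose fixed points `v` solve `v t = ∫ s in 0..t, S (t - s) (F (u_{s-δ}))` with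
`u = b + v`. For `δ = 0` this is the mild formulation; for `δ > 0` the right-hand side at time `t`
only involves `v` up to time `t - δ`. -/
noncomputable def delayedStep (hS : IsC0Semigroup S) {F : C(Icc (-h) 0, E) → E}
    (hF : Continuous F) (hT : 0 ≤ T) (b : C(ℝ, E)) (δ : ℝ) (v : C(Icc 0 T, E)) : C(Icc 0 T, E) :=
  semigroupConvolution hS T
    ⟨fun s => F (historyOfSum h hT b v (s - δ)), hF.comp
      ((continuous_historyOfSum hT b).comp (f := fun s : ℝ => (v, s - δ)) (by fun_prop))⟩

section DelayedStep

variable (hS : IsC0Semigroup S) {F : C(Icc (-h) 0, E) → E} (hF : Continuous F) (hT : 0 ≤ T)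
  (b : C(ℝ, E))

theorem delayedStep_apply (δ : ℝ) (v : C(Icc 0 T, E)) (t : Icc 0 T) :
    delayedStep hS hF hT b δ v t
      = ∫ s in (0 : ℝ)..t, S (max (t - s) 0) (F (historyOfSum h hT b v (s - δ))) := rfl

theorem continuous_delayedStep :
    Continuous fun p : ℝ × C(Icc 0 T, E) => delayedStep hS hF hT b p.1 p.2 := by
  refine ContinuousMap.continuous_of_continuous_uncurry _ ?_
  refine hS.continuous_integral (X := (ℝ × C(Icc 0 T, E)) × Icc 0 T) (τ := fun q => q.2)
    (g := fun q s => F (historyOfSum h hT b q.1.2 (s - q.1.1))) ?_ (by fun_prop)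
  exact hF.comp ((continuous_historyOfSum hT b).comp
    (f := fun q : ((ℝ × C(Icc 0 T, E)) × Icc 0 T) × ℝ => (q.1.1.2, q.2 - q.1.1.1)) (by fun_prop))

theorem delayedStep_congr {δ a : ℝ} (ha : 0 ≤ a) {v w : C(Icc 0 T, E)}
    (hvw : ∀ t : Icc 0 T, (t : ℝ) ≤ a → v t = w t) (t : Icc 0 T) (ht : (t : ℝ) ≤ a + δ) :
    delayedStep hS hF hT b δ v t = delayedStep hS hF hT b δ w t := by
  rw [delayedStep_apply, delayedStep_apply]
  refine intervalIntegral.integral_congr fun s hs => ?_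
  rw [uIcc_of_le t.2.1] at hs
  have : historyOfSum h hT b v (s - δ) = historyOfSum h hT b w (s - δ) := by
    ext θ
    rw [historyOfSum_apply, historyOfSum_apply, hvw]
    rw [coe_projIcc]
    exact max_le ha ((min_le_right _ _).trans (by linarith [hs.2, θ.2.2]))
  simp only [this]

/-- With a positive delay `δ` the iterates starting from `0` are stationary on `[0, kδ]` after
`k` steps, so that finitely many of them reach a fixed point. -/
theorem exists_iterate_delayedStep_fixed {δ : ℝ} (hδ : 0 < δ) :
    ∃ n : ℕ, delayedStep hS hF hT b δ ((delayedStep hS hF hT b δ)^[n] 0)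
      = (delayedStep hS hF hT b δ)^[n] 0 := by
  have key : ∀ k : ℕ, ∀ t : Icc 0 T, (t : ℝ) ≤ k * δ →
      (delayedStep hS hF hT b δ)^[k + 1] 0 t = (delayedStep hS hF hT b δ)^[k] 0 t := by
    intro k
    induction k with
    | zero =>
      intro t ht
      have ht0 : (t : ℝ) = 0 := le_antisymm (by simpa using ht) t.2.1
      simp [delayedStep_apply, ht0]
    | succ k ih =>
      intro t ht
      have := delayedStep_congr hS hF hT b (δ := δ) (a := k * δ) (by positivity) ih t
        (by push_cast at ht; linarith)
      simpa only [Function.iterate_succ_apply'] using this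
  obtain ⟨n, hn⟩ := exists_nat_gt (T / δ)
  rw [div_lt_iff₀ hδ] at hn
  refine ⟨n, ?_⟩
  rw [← Function.iterate_succ_apply' (delayedStep hS hF hT b δ)]
  ext t
  exact key n t (t.2.2.trans hn.le)

/-- If every `delayedStep` maps the unit ball into itself and into one family of almost orbits of a
compact semigroup, then the mild formulation has a solution. It is a limit of fixed points of
`delayedStep` for delays tending to `0`. -/
theorem exists_delayedStep_zero_fixed (hc : IsCompactC0Semigroup S) {L : ℝ}
    (hL : ∀ δ, 0 ≤ δ → ∀ v : C(Icc 0 T, E), ‖v‖ ≤ 1 →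
      delayedStep hS hF hT b δ v ∈ almostOrbits S T L ∧ ‖delayedStep hS hF hT b δ v‖ ≤ 1) :
    ∃ v : C(Icc 0 T, E), delayedStep hS hF hT b 0 v = v := by
  have hfix : ∀ n : ℕ, ∃ v ∈ almostOrbits S T L,
      delayedStep hS hF hT b (1 / ((n : ℝ) + 1)) v = v := by
    intro n
    have hδ : 0 < 1 / ((n : ℝ) + 1) := by positivity
    obtain ⟨k, hk⟩ := exists_iterate_delayedStep_fixed hS hF hT b hδ
    have hball : ∀ j : ℕ, ‖(delayedStep hS hF hT b (1 / ((n : ℝ) + 1)))^[j] 0‖ ≤ 1 := by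
      intro j
      induction j with
      | zero => simp
      | succ j ih =>
        rw [Function.iterate_succ_apply']
        exact (hL _ hδ.le _ ih).2
    exact ⟨_, hk ▸ (hL _ hδ.le _ (hball k)).1, hk⟩
  choose v hv hfix using hfix
  obtain ⟨w, -, σ, hσ, hw⟩ := (isCompact_closure_almostOrbits hc T L).tendsto_subseq
    fun n => subset_closure (hv n)
  refine ⟨w, tendsto_nhds_unique ?_ hw⟩
  have hδ : Tendsto (fun n => 1 / ((σ n : ℝ) + 1)) atTop (𝓝 0) :=
    tendsto_one_div_add_atTop_nhds_zero_nat.comp hσ.tendsto_atTop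
  have := ((continuous_delayedStep hS hF hT b).tendsto (0, w)).comp (hδ.prodMk_nhds hw)
  exact this.congr fun n => hfix (σ n)

end DelayedStep

end Convolution

/-! ### Existence of mild solutions -/

section MildSolution

variable {E : Type*} [NormedAddCommGroup E] [NormedSpace ℝ E] [CompleteSpace E]
  {S : ℝ → E →L[ℝ] E} {h : ℝ}

/-- A fixed point of the undelayed step yields a mild solution `b + v`, for any continuous `b`
that equals `φ` on `[-h,0]` and the orbit of `φ 0` on `[0,T]`. -/
theorem isMildSolution_of_delayedStep_zero_fixed (hh : 0 ≤ h) (hS : IsC0Semigroup S)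
    {F : C(Icc (-h) 0, E) → E} (hF : Continuous F) {T : ℝ} (hT : 0 ≤ T)
    (φ : C(Icc (-h) 0, E)) {b : C(ℝ, E)} (hbφ : ∀ θ : Icc (-h) 0, b θ = φ θ)
    (hbS : ∀ t, 0 ≤ t → b t = S t (φ ⟨0, neg_nonpos.2 hh, le_rfl⟩))
    {v : C(Icc 0 T, E)} (hv : delayedStep hS hF hT b 0 v = v) :
    IsMildSolution hh S F φ T fun t => b t + v (projIcc 0 T hT t) := by
  set u : ℝ → E := fun t => b t + v (projIcc 0 T hT t) with hu
  have hproj : Continuous (projIcc 0 T hT) := continuous_projIcc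
  have hcont : Continuous u := by fun_prop
  have hhist : ∀ s, historySegment h u s = historyOfSum h hT b v s := by
    intro s
    ext θ
    have : Continuous fun θ : Icc (-h) 0 => u (s + θ) := by fun_prop
    rw [historySegment, dif_pos this]
    rfl
  have hinteg : ∀ t : ℝ, Continuous fun s => S (max (t - s) 0) (F (historySegment h u s)) := by
    intro t
    simp only [hhist]
    refine hS.continuous_apply.comp (f := fun s : ℝ => (t - s, F (historyOfSum h hT b v s)))
      (Continuous.prodMk (by fun_prop) (hF.comp ?_))
    exact (continuous_historyOfSum hT b).comp (f := fun s : ℝ => (v, s)) (by fun_prop)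
  have heq : ∀ t, 0 ≤ t → EqOn (fun s => S (max (t - s) 0) (F (historySegment h u s)))
      (fun s => S (t - s) (F (historySegment h u s))) (uIcc 0 t) := by
    intro t ht s hs
    rw [uIcc_of_le ht] at hs
    simp only [max_eq_left (sub_nonneg.2 hs.2)]
  refine ⟨hcont.continuousOn, fun θ => ?_, fun t ht => ?_, fun t ht => ?_⟩
  · have : v (projIcc 0 T hT θ) = 0 := by
      rw [projIcc_of_le_left hT θ.2.2, ← hv, delayedStep_apply, intervalIntegral.integral_same]
    simp only [hu, this, add_zero, hbφ]
  · exact ((hinteg t).continuousOn.congr (heq t ht.1).symm).intervalIntegrable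
  · rw [← intervalIntegral.integral_congr (heq t ht.1)]
    have h1 : v (projIcc 0 T hT t)
        = ∫ s in (0 : ℝ)..t, S (max (t - s) 0) (F (historySegment h u s)) := by
      rw [projIcc_of_mem hT ⟨ht.1, ht.2.le⟩, ← hv, delayedStep_apply]
      simp only [sub_zero, hhist]
    rw [← h1, ← hbS t ht.1]

/-- Local existence for a compact semigroup and a continuous nonlinearity that is bounded on
bounded sets. -/
theorem exists_isMildSolution (hh : 0 ≤ h) (hS : IsCompactC0Semigroup S)
    {F : C(Icc (-h) 0, E) → E} (hF : Continuous F)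
    (hbdd : ∀ R : ℝ, ∃ N : ℝ, ∀ ψ, ‖ψ‖ ≤ R → ‖F ψ‖ ≤ N) (φ : C(Icc (-h) 0, E)) :
    ∃ T : ℝ, 0 < T ∧ ∃ u : ℝ → E, IsMildSolution hh S F φ T u := by
  have hneg : -h ≤ 0 := neg_nonpos.2 hh
  have hS₀ := hS.toIsC0Semigroup
  obtain ⟨M, hM1, hM⟩ := hS₀.exists_norm_le 1
  set x₀ := φ ⟨0, hneg, le_rfl⟩ with hx₀
  let b : C(ℝ, E) := ⟨fun t => φ (projIcc (-h) 0 hneg t) + S (max t 0) x₀ - x₀, by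
    have h1 : Continuous fun t : ℝ => S (max t 0) x₀ :=
      hS₀.continuous_apply.comp (f := fun t : ℝ => (t, x₀)) (by fun_prop)
    exact ((φ.continuous.comp continuous_projIcc).add h1).sub continuous_const⟩
  have hb : ∀ t, b t = φ (projIcc (-h) 0 hneg t) + S (max t 0) x₀ - x₀ := fun _ => rfl
  have hbφ : ∀ θ : Icc (-h) 0, b θ = φ θ := fun θ => by
    simp [hb, max_eq_right θ.2.2, hS.map_zero]
  have hbS : ∀ t, 0 ≤ t → b t = S t x₀ := fun t ht => by
    rw [hb, max_eq_left ht, projIcc_of_right_le hneg ht, ← hx₀]; abel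
  have hb_norm : ∀ t ≤ 1, ‖b t‖ ≤ ‖φ‖ + M * ‖x₀‖ + ‖x₀‖ := fun t ht => by
    rw [hb]
    refine (norm_sub_le _ _).trans (add_le_add_left ((norm_add_le _ _).trans
      (add_le_add (φ.norm_coe_le_norm _) ?_)) _)
    exact (S _).le_of_opNorm_le (hM _ ⟨le_max_right _ _, max_le ht zero_le_one⟩) _
  obtain ⟨N, hN⟩ := hbdd (‖φ‖ + M * ‖x₀‖ + ‖x₀‖ + 1)
  have hN0 : 0 ≤ N := (norm_nonneg _).trans (hN 0 (by rw [norm_zero]; positivity))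
  -- The length of the interval is chosen such that `T * (M * N) ≤ 1`.
  set T : ℝ := 1 / (M * N + 1) with hTdef
  have hT0 : 0 < T := by positivity
  have hT1 : T ≤ 1 := by
    rw [hTdef, div_le_one (by positivity)]
    linarith [mul_nonneg (zero_le_one.trans hM1) hN0]
  have hTL : M * N * T ≤ 1 := by
    rw [hTdef, mul_one_div, div_le_one (by positivity)]
    linarith
  have hMT : ∀ t ∈ Icc 0 T, ‖S t‖ ≤ M := fun t ht => hM t ⟨ht.1, ht.2.trans hT1⟩
  obtain ⟨v, hv⟩ := exists_delayedStep_zero_fixed hS₀ hF hT0.le b hS (L := M * N) (by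
    intro δ hδ v hv
    have hmem : delayedStep hS₀ hF hT0.le b δ v ∈ almostOrbits S T (M * N) := by
      refine semigroupConvolution_mem_almostOrbits hS₀ hMT (by linarith) fun s hs => hN _ ?_
      refine (ContinuousMap.norm_le _ (by positivity)).2 fun θ => ?_
      rw [historyOfSum_apply]
      exact (norm_add_le _ _).trans (add_le_add
        (hb_norm _ (by linarith [hs.2, θ.2.2])) ((v.norm_coe_le_norm _).trans hv))
    refine ⟨hmem, (ContinuousMap.norm_le _ zero_le_one).2 fun t => ?_⟩
    have h0 : (0 : ℝ) ∈ Icc 0 T := ⟨le_rfl, hT0.le⟩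
    have := hmem.2 ⟨0, h0⟩ t t.2.1
    rw [hmem.1 ⟨0, h0⟩ rfl] at this
    simp only [map_zero, sub_zero] at this
    exact this.trans ((mul_le_mul_of_nonneg_left t.2.2 (by positivity)).trans hTL))
  exact ⟨T, hT0, _, isMildSolution_of_delayedStep_zero_fixed hh hS₀ hF hT0.le φ hbφ hbS hv⟩

end MildSolution

/-! ### The state-dependent delay -/

section StateDelay

variable {E : Type*} [NormedAddCommGroup E] {h : ℝ}

theorem continuous_stateDelayMap {B : E → E} {r : C(Icc (-h) 0, E) → Icc (0 : ℝ) h}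
    (hB : Continuous B) (hr : Continuous r) : Continuous (stateDelayMap B r) := by
  have hτ : Continuous fun φ : C(Icc (-h) 0, E) =>
      (⟨-(r φ : ℝ), neg_le_neg (r φ).2.2, neg_nonpos.2 (r φ).2.1⟩ : Icc (-h) 0) := by
    fun_prop
  exact hB.comp (continuous_eval.comp (continuous_id.prodMk hτ))

theorem exists_norm_stateDelayMap_le {B : E → E}
    (hB : ∀ M : Set E, Bornology.IsBounded M → Bornology.IsBounded (B '' M))
    (r : C(Icc (-h) 0, E) → Icc (0 : ℝ) h) (R : ℝ) :
    ∃ N : ℝ, ∀ ψ, ‖ψ‖ ≤ R → ‖stateDelayMap B r ψ‖ ≤ N := by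
  obtain ⟨N, hN⟩ := (hB _ (Metric.isBounded_closedBall (x := 0) (r := R))).exists_norm_le
  exact ⟨N, fun ψ hψ => hN _ ⟨_, mem_closedBall_zero_iff.2
    ((ψ.norm_coe_le_norm _).trans hψ), rfl⟩⟩

end StateDelay

theorem theorem1 {d : ℕ} (Ω : Set (EuclideanSpace ℝ (Fin d))) (hΩ : IsOpen Ω)
    (h : ℝ) (hh : 0 ≤ h)
    (A : L2 Ω →ₗ.[ℝ] L2 Ω) (S : ℝ → L2 Ω →L[ℝ] L2 Ω)
    (hS : IsCompactC0Semigroup S) (hA : IsInfinitesimalGenerator (-A) S)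
    (B : L2 Ω → L2 Ω)
    (hB_bdd : ∀ M : Set (L2 Ω), Bornology.IsBounded M → Bornology.IsBounded (B '' M))
    (hB_lip : ∃ K : ℝ≥0, LipschitzWith K B)
    (r : C(Icc (-h) 0, L2 Ω) → Icc (0 : ℝ) h)
    (hr : ∃ K : ℝ≥0, LipschitzWith K r) :
    ∀ φ : C(Icc (-h) 0, L2 Ω), ∃ tφ : ℝ, 0 < tφ ∧
      ∃ u : ℝ → L2 Ω, IsMildSolution hh S (stateDelayMap B r) φ tφ u := by
  obtain ⟨K, hK⟩ := hB_lip
  obtain ⟨K', hK'⟩ := hr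
  exact exists_isMildSolution hh hS (continuous_stateDelayMap hK.continuous hK'.continuous)
    (exists_norm_stateDelayMap_le hB_bdd r)
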